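/- Let $\Gamma$ be a finite connected simple $d$-valent graph; write $E^p$ for the set of oriented edges $pq$ issuing from a vertex $p$, and $\bar e$ for the reverse of an oriented edge $e$, with initial vertex $i(e)$ and terminal vertex $t(e)$. A connection $\theta$ on $\Gamma$ is a family of bijections $\theta_e\colon E^{i(e)}\to E^{t(e)}$ with $\theta_e(e)=\bar e$ and $\theta_{\bar e}=\theta_e^{-1}$; a compatibility system $\lambda$ is a family of maps $\lambda_e\colon E^{i(e)}\to\mathbb R_{>0}$ with $\lambda_{\bar e}\circ\theta_e=1/\lambda_e$. A function $\alpha\colon E_\Gamma\to\mathbb R^n$ on the oriented edges is $k$-independent if at every vertex the vectors on any at most $k$ distinct oriented edges are linearly independent, and effective if $\{\alpha(e): e\in E^p\}$ spans $\mathbb R^n$ for each $p$. The quadruple $(\Gamma,\alpha,\theta,\lambda)$ is a $d$-valent 1-skeleton in $\mathbb R^n$ if $\alpha$ is $2$-independent, $\alpha(\bar e)=-\alpha(e)$ for all $e$, and $\alpha(e')-\lambda_e(e')\,\alpha(\theta_e(e'))\in\mathbb R\,\alpha(e)$ for all $e$ and all $e'\in E^{i(e)}\setminus\{e\}$. A covector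 $\xi\in(\mathbb R^n)^*$ is generic for a subgraph if $\langle\xi,\alpha(e)\rangle\ne 0$ for all of its edges, and generic if this holds for $\Gamma$. A generic covector is polarizing if the orientation of $\Gamma$ by the edges with $\langle\xi,\alpha(e)\rangle>0$ has no oriented loop. A source of a subgraph is a vertex $p$ at which no oriented edge $e$ of the subgraph with $i(e)=p$ has $\langle\xi,\alpha(e)\rangle<0$. A subgraph is pointed if it has exactly one source with respect to some covector generic for it. A $2$-slice is a connected component of the graph formed by the edges with direction in some fixed $2$-dimensional subspace of $\mathbb R^n$ (and their end points). The 1-skeleton is noncyclic if it is $3$-independent, has a generic polarizing covector, and all its $2$-slices are pointed. A $2$-face (with respect to a generic $\xi$) is a connected $2$-valent subgraph $Q$, preserved by the connection ($\theta_e$ maps $E_Q^{i(e)}$ into $E_Q^{t(e)}$ for each edge $e$ of $Q$), with exactly one source. For a path $\gamma=(p_0,\dots,p_m)$ and $e\in E^{p_0}$ let $K_\gamma(e)=\theta_{p_{m-1}p_m}\circ\dots\circ\theta_{p_0p_1}(e)$, and let $|K_\gamma(e)|=\prod_{i=1}^m\lambda_{p_{i-1}p_i}(\theta_{p_{i-2}p_{i-1}}\circ\dots\circ\theta_{p_0p_1}(e))$.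 $Q$ has trivial normal holonomy if $K_\gamma(e)=e$ for every loop $\gamma$ in $Q$ and every oriented edge $e$ not in $Q$ issuing from the base point of $\gamma$; $Q$ is level if $|K_\gamma(e)|=1$ for all such $\gamma,e$ with $K_\gamma(e)=e$. **Corollary.** Let $(\Gamma,\alpha,\theta,\lambda)$ be a $d$-valent 1-skeleton in $\mathbb R^n$. 1. If it is $k$-independent for some $k\ge 3$, then every $2$-face, with respect to any generic covector, is level. 2. If it is $k$-independent for some $k\ge 4$, then every $2$-face, with respect to any generic covector, is level and has trivial normal holonomy. 3. If it is $4$-independent and noncyclic, then it has a total lift: there are an effective, $d$-independent function $A\colon E_\Gamma\to\mathbb R^d$ such that $(\Gamma,A,\theta,\lambda)$ is a noncyclic 1-skeleton in $\mathbb R^d$, and a linear map $\pi\colon\mathbb R^d\to\mathbb R^n$ with $\alpha=\pi\circ A$ whose image is the linear span of all the vectors $\alpha(e)$. In particular, $\pi$ is surjective if $\alpha$ is effective. -/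

import Mathlib

/-- A connected `d`-valent simple graph with a connection and a compatibility system
(a *pre 1-skeleton*).  The oriented edges at a vertex `p` are the elements of `G.neighborSet p`:
the neighbour `q` of `p` stands for the oriented edge `pq`. -/
structure PreOneSkeleton (V : Type*) (d : ℕ) where
  /-- the underlying graph -/
  G : SimpleGraph V
  connected : G.Connected
  valency : ∀ p, (G.neighborSet p).ncard = d
  /-- the connection: for an oriented edge `pq`, a bijection between the oriented edges at `p`
  and the oriented edges at `q` -/
  conn : ∀ {p q : V}, G.Adj p q → (G.neighborSet p ≃ G.neighborSet q)
  conn_self : ∀ {p q : V} (h : G.Adj p q), conn h ⟨q, h⟩ = ⟨p, h.symm⟩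
  conn_symm : ∀ {p q : V} (h : G.Adj p q), conn h.symm = (conn h).symm
  /-- the compatibility constants -/
  lam : ∀ {p q : V}, G.Adj p q → G.neighborSet p → ℝ
  lam_pos : ∀ {p q : V} (h : G.Adj p q) (e : G.neighborSet p), 0 < lam h e
  lam_conn : ∀ {p q : V} (h : G.Adj p q) (e : G.neighborSet p),
    lam h.symm (conn h e) = (lam h e)⁻¹

namespace PreOneSkeleton

/-- The functions from the oriented edges to `ℝⁿ`; `α p ⟨q, h⟩` is the value at `pq`. -/
abbrev EdgeFun {V : Type*} {d : ℕ} (P : PreOneSkeleton V d) (n : ℕ) : Type _ :=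
  ∀ p : V, P.G.neighborSet p → (Fin n → ℝ)

/-- `k`-independence: at each vertex, the vectors on any `k` (or fewer) oriented edges are
linearly independent.  If `k ≤ d` it is enough to look at sets of exactly `k` edges; for `k > d`
the condition is `d`-independence, so that `k`-independence always implies `j`-independence for
`j ≤ k`. -/
def IsIndependent {V : Type*} {d : ℕ} (P : PreOneSkeleton V d) {n : ℕ} (k : ℕ)
    (α : P.EdgeFun n) : Prop :=
  ∀ (p : V) (s : Finset (P.G.neighborSet p)), s.card ≤ k →
    LinearIndependent ℝ (fun e : s => α p e)

/-- `α` is effective: the vectors at each vertex span `ℝⁿ`. -/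
def IsEffective {V : Type*} {d : ℕ} (P : PreOneSkeleton V d) {n : ℕ} (α : P.EdgeFun n) : Prop :=
  ∀ p : V, Submodule.span ℝ (Set.range (α p)) = ⊤

/-- `α` is an axial function, with compatibility system that of `P`; that is, `(P, α)` is a
1-skeleton in `ℝⁿ`. -/
structure IsAxial {V : Type*} {d : ℕ} (P : PreOneSkeleton V d) {n : ℕ} (α : P.EdgeFun n) :
    Prop where
  pairwise_indep : P.IsIndependent 2 α
  reverse : ∀ {p q : V} (h : P.G.Adj p q), α p ⟨q, h⟩ = -α q ⟨p, h.symm⟩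
  compat : ∀ {p q : V} (h : P.G.Adj p q) (e : P.G.neighborSet p), e ≠ ⟨q, h⟩ →
    ∃ c : ℝ, α p e - P.lam h e • α q (P.conn h e) = c • α p ⟨q, h⟩

/-- The path-connection map of a path: the composition of the connection maps along it. -/
def pathConn {V : Type*} {d : ℕ} (P : PreOneSkeleton V d) :
    ∀ {p q : V}, P.G.Walk p q → (P.G.neighborSet p ≃ P.G.neighborSet q)
  | _, _, .nil => Equiv.refl _
  | _, _, .cons h γ => (P.conn h).trans (P.pathConn γ)

/-- The local path-connection number of a path at an oriented edge `e`: the product of the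
compatibility constants met while `e` is transported along the path. -/
noncomputable def pathNumber {V : Type*} {d : ℕ} (P : PreOneSkeleton V d) :
    ∀ {p q : V}, P.G.Walk p q → P.G.neighborSet p → ℝ
  | _, _, .nil, _ => 1
  | _, _, .cons h γ, e => P.lam h e * P.pathNumber γ (P.conn h e)

/-- `H` is (the graph of) a `k`-valent subskeleton: a connected `k`-valent totally geodesic
subgraph. -/
structure IsSubskeleton {V : Type*} {d : ℕ} (P : PreOneSkeleton V d) (k : ℕ)
    (H : P.G.Subgraph) : Prop where
  connected : H.Connected
  valency : ∀ p ∈ H.verts, (H.neighborSet p).ncard = k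
  totally_geodesic : ∀ {p q : V} (h : H.Adj p q) (e : P.G.neighborSet p),
    H.Adj p e → H.Adj q (P.conn h.adj_sub e)

/-- Trivial normal holonomy: transport along any loop in `H` fixes every normal edge. -/
def HasTrivialNormalHolonomy {V : Type*} {d : ℕ} (P : PreOneSkeleton V d)
    (H : P.G.Subgraph) : Prop :=
  ∀ (p : V) (γ : P.G.Walk p p), γ.toSubgraph ≤ H →
    ∀ e : P.G.neighborSet p, ¬ H.Adj p e → P.pathConn γ e = e

/-- `H` is level: each loop in `H` that fixes a normal edge has local holonomy number `1`
there. -/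
def IsLevel {V : Type*} {d : ℕ} (P : PreOneSkeleton V d) (H : P.G.Subgraph) : Prop :=
  ∀ (p : V) (γ : P.G.Walk p p), γ.toSubgraph ≤ H →
    ∀ e : P.G.neighborSet p, ¬ H.Adj p e → P.pathConn γ e = e → P.pathNumber γ e = 1

/-- The covector `ξ` is generic on the subgraph `H`: it vanishes on no edge direction of `H`. -/
def IsGenericOn {V : Type*} {d : ℕ} (P : PreOneSkeleton V d) {n : ℕ} (α : P.EdgeFun n)
    (H : P.G.Subgraph) (ξ : Module.Dual ℝ (Fin n → ℝ)) : Prop :=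
  ∀ {p q : V} (h : H.Adj p q), ξ (α p ⟨q, h.adj_sub⟩) ≠ 0

/-- `pq` is a directed edge for the orientation induced by `ξ`. -/
def IsDirected {V : Type*} {d : ℕ} (P : PreOneSkeleton V d) {n : ℕ} (α : P.EdgeFun n)
    (ξ : Module.Dual ℝ (Fin n → ℝ)) (p q : V) : Prop :=
  ∃ h : P.G.Adj p q, 0 < ξ (α p ⟨q, h⟩)

/-- `ξ` is a generic polarizing covector: the induced orientation has no oriented loops. -/
def IsPolarizing {V : Type*} {d : ℕ} (P : PreOneSkeleton V d) {n : ℕ} (α : P.EdgeFun n)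
    (ξ : Module.Dual ℝ (Fin n → ℝ)) : Prop :=
  P.IsGenericOn α ⊤ ξ ∧ ∀ p : V, ¬ Relation.TransGen (P.IsDirected α ξ) p p

/-- The index of the vertex `p` in the subgraph `H`: the number of edges of `H` flowing
into `p`. -/
noncomputable def index {V : Type*} {d : ℕ} (P : PreOneSkeleton V d) {n : ℕ} (α : P.EdgeFun n)
    (H : P.G.Subgraph) (ξ : Module.Dual ℝ (Fin n → ℝ)) (p : V) : ℕ :=
  {e : P.G.neighborSet p | H.Adj p e ∧ ξ (α p e) < 0}.ncard

/-- The `i`-th combinatorial Betti number of `H`, computed with the covector `ξ`. -/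
noncomputable def betti {V : Type*} {d : ℕ} (P : PreOneSkeleton V d) {n : ℕ} (α : P.EdgeFun n)
    (H : P.G.Subgraph) (ξ : Module.Dual ℝ (Fin n → ℝ)) (i : ℕ) : ℕ :=
  {p : V | p ∈ H.verts ∧ P.index α H ξ p = i}.ncard

/-- `H` is pointed: it has exactly one source for some generic covector. -/
def IsPointed {V : Type*} {d : ℕ} (P : PreOneSkeleton V d) {n : ℕ} (α : P.EdgeFun n)
    (H : P.G.Subgraph) : Prop :=
  ∃ ξ : Module.Dual ℝ (Fin n → ℝ), P.IsGenericOn α H ξ ∧ P.betti α H ξ 0 = 1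

/-- A `k`-face, with respect to a generic covector `ξ`: a `k`-valent subskeleton with exactly one
source. -/
def IsFace {V : Type*} {d : ℕ} (P : PreOneSkeleton V d) {n : ℕ} (α : P.EdgeFun n)
    (ξ : Module.Dual ℝ (Fin n → ℝ)) (k : ℕ) (H : P.G.Subgraph) : Prop :=
  P.IsSubskeleton k H ∧ P.betti α H ξ 0 = 1

/-- `H` is a `k`-slice: for some `k`-dimensional subspace `W`, it is a connected component of the
graph formed by the edges with direction in `W` and their end points. -/
def IsSlice {V : Type*} {d : ℕ} (P : PreOneSkeleton V d) {n : ℕ} (α : P.EdgeFun n)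
    (k : ℕ) (H : P.G.Subgraph) : Prop :=
  ∃ W : Submodule ℝ (Fin n → ℝ), Module.finrank ℝ W = k ∧
    H.Connected ∧ (∃ p q : V, H.Adj p q) ∧
    ∀ p q : V, H.Adj p q ↔ p ∈ H.verts ∧ ∃ h : P.G.Adj p q, α p ⟨q, h⟩ ∈ W

/-- The 1-skeleton `(P, α)` is noncyclic: it is 3-independent, it admits a polarization, and
every 2-slice is pointed. -/
structure IsNoncyclic {V : Type*} {d : ℕ} (P : PreOneSkeleton V d) {n : ℕ} (α : P.EdgeFun n) :
    Prop where
  three_indep : P.IsIndependent 3 α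
  polarization : ∃ ξ : Module.Dual ℝ (Fin n → ℝ), P.IsPolarizing α ξ
  slices_pointed : ∀ H : P.G.Subgraph, P.IsSlice α 2 H → P.IsPointed α H

/-- The 1-skeleton `(P, A)` in `ℝᵈ` (same graph, connection and compatibility system) is a total
lift of `(P, α)` through the linear map `π`: `A` is an effective axial function, `α = π ∘ A`, and
`π` maps onto the linear span of the edge directions of `α`.  When `α` is effective, that span is
all of `ℝⁿ` and the last condition is surjectivity of `π`. -/
structure IsTotalLift {V : Type*} {d : ℕ} (P : PreOneSkeleton V d) {n : ℕ} (α : P.EdgeFun n)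
    (A : P.EdgeFun d) (π : (Fin d → ℝ) →ₗ[ℝ] (Fin n → ℝ)) : Prop where
  axial : P.IsAxial A
  effective : P.IsEffective A
  proj : ∀ (p : V) (e : P.G.neighborSet p), π (A p e) = α p e
  range_eq : LinearMap.range π =
    Submodule.span ℝ {v | ∃ (p : V) (e : P.G.neighborSet p), α p e = v}

end PreOneSkeleton

namespace PreOneSkeleton

variable {V : Type*} {d n : ℕ} {P : PreOneSkeleton V d} {α : P.EdgeFun n}

/-! The compatibility relations express each edge vector at `p` through edge vectors at a neighbour
`q`. Read in the free vector spaces on the edges at each vertex, they define a transport (`step`,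
`transport`) that commutes with evaluation by `α`. Hence transport around a loop changes a formal
combination only by a linear relation between edge vectors.

For a loop in a 2-valent subskeleton, the image of an edge `e` is its path-connection number times
`K(e)`, plus a combination of the two edges of the subskeleton (`transport_single_sub_mem_tangent`).
The change therefore involves at most four edges, or three if `K(e) = e`, and 4- or 3-independence
makes it vanish. Comparing coefficients gives levelness and trivial normal holonomy.

For the lift, it suffices to find isomorphisms of these free spaces with one `ℝᵈ` that are
compatible with transport: the images of the basis edges define `A`, and evaluation by `α` descends
to `π`. The isomorphisms are built upwards along a polarization. If a new vertex has two lower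
neighbours, the 2-slice through the two edges has a unique source; walks descend to it from both
neighbours, and trivial transport around loops of the slice makes the two prescriptions agree
(`IsFlatOn.step_eq_step`). Pointedness gives one source for some covector only; `betti_zero_eq`
carries this over to the polarizing one. -/

theorem IsIndependent.mono {j k : ℕ} (hk : P.IsIndependent k α) (hjk : j ≤ k) :
    P.IsIndependent j α :=
  fun p s hs => hk p s (hs.trans hjk)

/-- A relation between the edge vectors at a vertex that involves at most `k` edges is trivial. -/
theorem IsIndependent.eq_zero {k : ℕ} (hk : P.IsIndependent k α) {p : V}
    (s : Finset (P.G.neighborSet p)) (hs : s.card ≤ k) {x : P.G.neighborSet p →₀ ℝ}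
    (hx : ∀ e, e ∉ s → x e = 0) (h0 : Finsupp.linearCombination ℝ (α p) x = 0) : x = 0 := by
  have h : LinearIndepOn ℝ (α p) (s : Set (P.G.neighborSet p)) := hk p s hs
  exact linearIndepOn_iff.mp h x
    ((Finsupp.mem_supported' ℝ x).2 fun e he => hx e (by simpa using he)) h0

theorem IsIndependent.ne_zero {k : ℕ} (hk : P.IsIndependent k α) (h1 : 1 ≤ k) {p : V}
    (e : P.G.neighborSet p) : α p e ≠ 0 := by
  intro h0
  have := hk.eq_zero {e} (by simpa using h1) (x := Finsupp.single e 1)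
    (fun f hf => Finsupp.single_eq_of_ne (by simpa using hf)) (by simp [h0])
  simp at this

/-! ### Transport of formal combinations of edges -/

namespace IsAxial

theorem ne_zero (hα : P.IsAxial α) {p : V} (e : P.G.neighborSet p) : α p e ≠ 0 :=
  hα.pairwise_indep.ne_zero (by norm_num) e

/-- The edge `pq` itself is included, with the coefficient that makes up for whatever value `lam`
takes there, so that transport can be defined uniformly on all edges. -/
theorem exists_coeff (hα : P.IsAxial α) {p q : V} (h : P.G.Adj p q) (e : P.G.neighborSet p) :
    ∃ c : ℝ, α p e = P.lam h e • α q (P.conn h e) - c • α q ⟨p, h.symm⟩ := by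
  by_cases he : e = ⟨q, h⟩
  · refine ⟨P.lam h e + 1, ?_⟩
    subst he
    rw [P.conn_self, hα.reverse h]
    module
  · obtain ⟨c, hc⟩ := hα.compat h e he
    refine ⟨c, ?_⟩
    rw [hα.reverse h, smul_neg] at hc
    linear_combination (exp := 1) hc

/-- The coefficient of the edge `qp` in the expansion of `α` at an edge issuing from `p`, along
the edge `pq`. -/
noncomputable def coeff (hα : P.IsAxial α) {p q : V} (h : P.G.Adj p q)
    (e : P.G.neighborSet p) : ℝ :=
  (hα.exists_coeff h e).choose

theorem coeff_spec (hα : P.IsAxial α) {p q : V} (h : P.G.Adj p q) (e : P.G.neighborSet p) :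
    α p e = P.lam h e • α q (P.conn h e) - hα.coeff h e • α q ⟨p, h.symm⟩ :=
  (hα.exists_coeff h e).choose_spec

/-- The transport of formal combinations of edges along an edge. -/
noncomputable def step (hα : P.IsAxial α) {p q : V} (h : P.G.Adj p q) :
    (P.G.neighborSet p →₀ ℝ) →ₗ[ℝ] (P.G.neighborSet q →₀ ℝ) :=
  Finsupp.linearCombination ℝ fun e =>
    Finsupp.single (P.conn h e) (P.lam h e) - Finsupp.single ⟨p, h.symm⟩ (hα.coeff h e)

theorem step_single (hα : P.IsAxial α) {p q : V} (h : P.G.Adj p q) (e : P.G.neighborSet p) :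
    hα.step h (Finsupp.single e 1) =
      P.lam h e • Finsupp.single (P.conn h e) 1 -
        hα.coeff h e • Finsupp.single ⟨p, h.symm⟩ 1 := by
  simp [step]

theorem linearCombination_step (hα : P.IsAxial α) {p q : V} (h : P.G.Adj p q)
    (x : P.G.neighborSet p →₀ ℝ) :
    Finsupp.linearCombination ℝ (α q) (hα.step h x) = Finsupp.linearCombination ℝ (α p) x := by
  suffices (Finsupp.linearCombination ℝ (α q)).comp (hα.step h) =
      Finsupp.linearCombination ℝ (α p) from LinearMap.congr_fun this x
  refine Finsupp.lhom_ext' fun e => LinearMap.ext_ring ?_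
  simp only [LinearMap.comp_apply, Finsupp.lsingle_apply, step_single, map_sub, map_smul,
    Finsupp.linearCombination_single, one_smul]
  exact (hα.coeff_spec h e).symm

/-- Both sides are multiples of one basis edge, and `α` is nonzero on it, so the reversal rule for
`α` determines the multiple. -/
theorem step_self (hα : P.IsAxial α) {p q : V} (h : P.G.Adj p q) :
    hα.step h (Finsupp.single ⟨q, h⟩ 1) = -Finsupp.single ⟨p, h.symm⟩ 1 := by
  have h0 := hα.linearCombination_step h (Finsupp.single ⟨q, h⟩ 1)
  rw [hα.step_single, P.conn_self, ← sub_smul] at h0 ⊢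
  have h1 := hα.reverse h
  simp only [map_smul, Finsupp.linearCombination_single, one_smul] at h0
  rw [h1, ← neg_one_smul ℝ] at h0
  rw [smul_left_injective ℝ (hα.ne_zero _) h0, neg_one_smul]

theorem step_symm_step (hα : P.IsAxial α) {p q : V} (h : P.G.Adj p q)
    (x : P.G.neighborSet p →₀ ℝ) : hα.step h.symm (hα.step h x) = x := by
  suffices (hα.step h.symm).comp (hα.step h) = LinearMap.id from LinearMap.congr_fun this x
  refine Finsupp.lhom_ext' fun e => LinearMap.ext_ring ?_
  simp only [LinearMap.comp_apply, Finsupp.lsingle_apply, LinearMap.id_apply]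
  rw [← sub_eq_zero]
  have hl := (P.lam_pos h e).ne'
  -- Going forth and back alters a basis edge only by a multiple of `pq`; evaluation by `α` is
  -- preserved and `α` is nonzero on `pq`, so the multiple is zero.
  refine hα.pairwise_indep.eq_zero {⟨q, h⟩} (by simp) (fun f hf => ?_) ?_
  · have hf' : f ≠ ⟨q, h⟩ := by simpa using hf
    rw [hα.step_single, map_sub, map_smul, map_smul, hα.step_self h.symm, hα.step_single,
      P.lam_conn, P.conn_symm h, Equiv.symm_apply_apply, smul_sub, smul_smul, mul_inv_cancel₀ hl]
    simp [hf']
  · rw [map_sub, linearCombination_step, linearCombination_step, sub_self]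

/-- The transport of formal combinations of edges along an edge, as an equivalence. -/
noncomputable def stepEquiv (hα : P.IsAxial α) {p q : V} (h : P.G.Adj p q) :
    (P.G.neighborSet p →₀ ℝ) ≃ₗ[ℝ] (P.G.neighborSet q →₀ ℝ) :=
  LinearEquiv.ofLinearMap (hα.step h) (hα.step h.symm)
    (LinearMap.ext fun x => hα.step_symm_step h.symm x)
    (LinearMap.ext fun x => hα.step_symm_step h x)

theorem stepEquiv_apply (hα : P.IsAxial α) {p q : V} (h : P.G.Adj p q)
    (x : P.G.neighborSet p →₀ ℝ) : hα.stepEquiv h x = hα.step h x := rfl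

/-- The transport of formal combinations of edges along a walk. -/
noncomputable def transport (hα : P.IsAxial α) : ∀ {p q : V}, P.G.Walk p q →
    (P.G.neighborSet p →₀ ℝ) →ₗ[ℝ] (P.G.neighborSet q →₀ ℝ)
  | _, _, .nil => LinearMap.id
  | _, _, .cons h γ => (hα.transport γ).comp (hα.step h)

theorem transport_nil (hα : P.IsAxial α) {p : V} (x : P.G.neighborSet p →₀ ℝ) :
    hα.transport (.nil : P.G.Walk p p) x = x := rfl

theorem transport_cons (hα : P.IsAxial α) {p q r : V} (h : P.G.Adj p q) (γ : P.G.Walk q r)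
    (x : P.G.neighborSet p →₀ ℝ) :
    hα.transport (.cons h γ) x = hα.transport γ (hα.step h x) := rfl

theorem linearCombination_transport (hα : P.IsAxial α) {p q : V} (γ : P.G.Walk p q)
    (x : P.G.neighborSet p →₀ ℝ) :
    Finsupp.linearCombination ℝ (α q) (hα.transport γ x) =
      Finsupp.linearCombination ℝ (α p) x := by
  induction γ with
  | nil => rfl
  | cons h γ ih => rw [transport_cons, ih, linearCombination_step]

theorem transport_append (hα : P.IsAxial α) {p q r : V} (γ : P.G.Walk p q) (δ : P.G.Walk q r)
    (x : P.G.neighborSet p →₀ ℝ) :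
    hα.transport (γ.append δ) x = hα.transport δ (hα.transport γ x) := by
  induction γ with
  | nil => rfl
  | cons h γ ih => rw [SimpleGraph.Walk.cons_append, transport_cons, transport_cons, ih]

theorem transport_transport_reverse (hα : P.IsAxial α) {p q : V} (γ : P.G.Walk p q)
    (x : P.G.neighborSet q →₀ ℝ) : hα.transport γ (hα.transport γ.reverse x) = x := by
  induction γ with
  | nil => rfl
  | cons h γ ih =>
    rw [SimpleGraph.Walk.reverse_cons, transport_append, transport_cons, transport_cons,
      transport_nil, hα.step_symm_step h.symm, ih]

end IsAxial

/-! ### Loops in totally geodesic subgraphs -/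

/-- The subgraph `H` is totally geodesic: it is preserved by the connection. -/
def IsGeodesic (P : PreOneSkeleton V d) (H : P.G.Subgraph) : Prop :=
  ∀ {p q : V} (h : H.Adj p q) (e : P.G.neighborSet p),
    H.Adj p e → H.Adj q (P.conn h.adj_sub e)

/-- The formal combinations of edges of `H` at the vertex `p`. -/
def tangent (P : PreOneSkeleton V d) (H : P.G.Subgraph) (p : V) :
    Submodule ℝ (P.G.neighborSet p →₀ ℝ) :=
  Finsupp.supported ℝ ℝ {e | H.Adj p e}

theorem toSubgraph_cons_le {H : P.G.Subgraph} {p q r : V} {h : P.G.Adj p q}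
    {γ : P.G.Walk q r} : (SimpleGraph.Walk.cons h γ).toSubgraph ≤ H ↔
      H.Adj p q ∧ γ.toSubgraph ≤ H := by
  rw [SimpleGraph.Walk.toSubgraph, sup_le_iff]
  refine and_congr_left fun _ => ⟨fun hle => hle.2 (by simp), fun hH => ?_⟩
  exact SimpleGraph.subgraphOfAdj_le_of_adj H hH

namespace IsAxial

theorem step_mem_tangent (hα : P.IsAxial α) {H : P.G.Subgraph} (hH : P.IsGeodesic H) {p q : V}
    (h : H.Adj p q) {x : P.G.neighborSet p →₀ ℝ} (hx : x ∈ P.tangent H p) :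
    hα.step h.adj_sub x ∈ P.tangent H q := by
  rw [tangent, Finsupp.supported_eq_span_single] at hx
  suffices Submodule.span ℝ ((fun e : P.G.neighborSet p => Finsupp.single e (1 : ℝ)) ''
      {e | H.Adj p e}) ≤ (P.tangent H q).comap (hα.step h.adj_sub) from this hx
  rw [Submodule.span_le]
  rintro _ ⟨e, he, rfl⟩
  rw [SetLike.mem_coe, Submodule.mem_comap, hα.step_single]
  exact Submodule.sub_mem _
    (Submodule.smul_mem _ _ (Finsupp.single_mem_supported ℝ _ (hH h e he)))
    (Submodule.smul_mem _ _ (Finsupp.single_mem_supported ℝ _ h.symm))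

theorem transport_mem_tangent (hα : P.IsAxial α) {H : P.G.Subgraph} (hH : P.IsGeodesic H)
    {p q : V} (γ : P.G.Walk p q) (hγ : γ.toSubgraph ≤ H) {x : P.G.neighborSet p →₀ ℝ}
    (hx : x ∈ P.tangent H p) : hα.transport γ x ∈ P.tangent H q := by
  induction γ with
  | nil => exact hx
  | cons h γ ih =>
    rw [toSubgraph_cons_le] at hγ
    exact ih hγ.2 (hα.step_mem_tangent hH hγ.1 hx)

/-- Modulo the edges of a totally geodesic subgraph, transport along its walks is given by the
path-connection map and the path-connection numbers. -/
theorem transport_single_sub_mem_tangent (hα : P.IsAxial α) {H : P.G.Subgraph}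
    (hH : P.IsGeodesic H) {p q : V} (γ : P.G.Walk p q) (hγ : γ.toSubgraph ≤ H)
    (e : P.G.neighborSet p) :
    hα.transport γ (Finsupp.single e 1) - P.pathNumber γ e • Finsupp.single (P.pathConn γ e) 1 ∈
      P.tangent H q := by
  induction γ with
  | nil => simp [transport_nil, pathNumber, pathConn]
  | cons h γ ih =>
    rw [toSubgraph_cons_le] at hγ
    have h1 := Submodule.smul_mem _ (P.lam h e) (ih hγ.2 (P.conn h e))
    have h2 : Finsupp.single ⟨_, h.symm⟩ (1 : ℝ) ∈ P.tangent H _ :=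
      Finsupp.single_mem_supported ℝ _ hγ.1.symm
    have h3 := Submodule.smul_mem _ (hα.coeff h e) (hα.transport_mem_tangent hH γ hγ.2 h2)
    have h4 := Submodule.sub_mem _ h1 h3
    rw [transport_cons, step_single, map_sub, map_smul, map_smul]
    simp only [pathNumber, pathConn, Equiv.trans_apply]
    convert h4 using 1
    module

/-- If the edges of `H`, `e` and its image under a loop in `H` lie in a set of at most `k` edges
and `α` is `k`-independent, then `e` is preserved by transport along the loop. -/
theorem transport_single_eq (hα : P.IsAxial α) {H : P.G.Subgraph} (hH : P.IsGeodesic H) {k : ℕ}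
    (hk : P.IsIndependent k α) {p : V} (γ : P.G.Walk p p) (hγ : γ.toSubgraph ≤ H)
    (e : P.G.neighborSet p) (s : Finset (P.G.neighborSet p)) (hs : s.card ≤ k)
    (hHs : ∀ f : P.G.neighborSet p, H.Adj p f → f ∈ s) (hes : e ∈ s)
    (hKs : P.pathConn γ e ∈ s) :
    hα.transport γ (Finsupp.single e 1) = Finsupp.single e 1 := by
  rw [← sub_eq_zero]
  refine hk.eq_zero s hs (fun f hf => ?_) ?_
  · have h1 := hα.transport_single_sub_mem_tangent hH γ hγ e
    have h2 := (Finsupp.mem_supported' ℝ _).1 h1 f fun h => hf (hHs f h)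
    have h3 : P.pathConn γ e ≠ f := fun h => hf (h ▸ hKs)
    have h4 : e ≠ f := fun h => hf (h ▸ hes)
    simpa [Finsupp.single_apply, h3, h4] using h2
  · rw [map_sub, linearCombination_transport, sub_self]

end IsAxial

theorem IsSubskeleton.exists_neighbors {H : P.G.Subgraph} (hH : P.IsSubskeleton 2 H) {p : V}
    (hp : p ∈ H.verts) : ∃ a b : P.G.neighborSet p, a ≠ b ∧
      ∀ e : P.G.neighborSet p, H.Adj p e ↔ e = a ∨ e = b := by
  obtain ⟨a, b, hab, h⟩ := Set.ncard_eq_two.mp (hH.valency p hp)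
  have hx : ∀ x, H.Adj p x ↔ x = a ∨ x = b := fun x => by
    rw [← SimpleGraph.Subgraph.mem_neighborSet, h]; simp
  refine ⟨⟨a, ((hx a).2 (.inl rfl)).adj_sub⟩, ⟨b, ((hx b).2 (.inr rfl)).adj_sub⟩,
    fun h => hab (congrArg Subtype.val h), fun e => ?_⟩
  rw [hx, Subtype.ext_iff, Subtype.ext_iff]

theorem mem_verts_of_toSubgraph_le {H : P.G.Subgraph} {p q : V} {γ : P.G.Walk p q}
    (hγ : γ.toSubgraph ≤ H) : p ∈ H.verts :=
  hγ.1 (SimpleGraph.Walk.start_mem_verts_toSubgraph γ)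

namespace IsAxial

/-- The edge, its image under the path connection and the two edges of `H` number at most four,
which is where 4-independence enters. -/
theorem transport_loop (hα : P.IsAxial α) (h4 : P.IsIndependent 4 α) {H : P.G.Subgraph}
    (hH : P.IsSubskeleton 2 H) {p : V} (γ : P.G.Walk p p) (hγ : γ.toSubgraph ≤ H)
    (x : P.G.neighborSet p →₀ ℝ) : hα.transport γ x = x := by
  classical
  suffices hα.transport γ = LinearMap.id from LinearMap.congr_fun this x
  refine Finsupp.lhom_ext' fun e => LinearMap.ext_ring ?_
  obtain ⟨a, b, -, hab⟩ := hH.exists_neighbors (mem_verts_of_toSubgraph_le hγ)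
  refine hα.transport_single_eq hH.totally_geodesic h4 γ hγ e {e, P.pathConn γ e, a, b}
    Finset.card_le_four (fun f hf => ?_) (by simp) (by simp)
  rcases (hab f).1 hf with rfl | rfl <;> simp

/-- When `K(e) = e`, three edges suffice to show that `e` is fixed by transport; the path-connection
number is then its coefficient at `e`, hence 1. -/
theorem isLevel (hα : P.IsAxial α) (h3 : P.IsIndependent 3 α) {H : P.G.Subgraph}
    (hH : P.IsSubskeleton 2 H) : P.IsLevel H := by
  classical
  intro p γ hγ e he hKe
  obtain ⟨a, b, -, hab⟩ := hH.exists_neighbors (mem_verts_of_toSubgraph_le hγ)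
  have h1 := hα.transport_single_eq hH.totally_geodesic h3 γ hγ e {e, a, b}
    Finset.card_le_three (fun f hf => by rcases (hab f).1 hf with rfl | rfl <;> simp)
    (by simp) (by simp [hKe])
  have h2 := hα.transport_single_sub_mem_tangent hH.totally_geodesic γ hγ e
  rw [h1, hKe] at h2
  have := (Finsupp.mem_supported' ℝ _).1 h2 e he
  simp at this
  linarith

/-- Transport fixes `e`, so the coefficient at `e` is 1; if `K(e)` were another edge, that
coefficient would be 0 modulo the edges of `H`. -/
theorem hasTrivialNormalHolonomy (hα : P.IsAxial α) (h4 : P.IsIndependent 4 α)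
    {H : P.G.Subgraph} (hH : P.IsSubskeleton 2 H) : P.HasTrivialNormalHolonomy H := by
  intro p γ hγ e he
  by_contra hne
  have h2 := hα.transport_single_sub_mem_tangent hH.totally_geodesic γ hγ e
  rw [hα.transport_loop h4 hH γ hγ] at h2
  have := (Finsupp.mem_supported' ℝ _).1 h2 e he
  simp [hne] at this

/-- Transport between two vertices of a 2-valent subskeleton does not depend on the walk. -/
theorem transport_eq_transport (hα : P.IsAxial α) (h4 : P.IsIndependent 4 α)
    {H : P.G.Subgraph} (hH : P.IsSubskeleton 2 H) {p q : V} (γ δ : P.G.Walk p q)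
    (hγ : γ.toSubgraph ≤ H) (hδ : δ.toSubgraph ≤ H) (x : P.G.neighborSet p →₀ ℝ) :
    hα.transport γ x = hα.transport δ x := by
  have h1 := hα.transport_loop h4 hH (γ.append δ.reverse)
    (by rw [SimpleGraph.Walk.toSubgraph_append, SimpleGraph.Walk.toSubgraph_reverse]
        exact sup_le hγ hδ) x
  rw [transport_append] at h1
  rw [← hα.transport_transport_reverse δ (hα.transport γ x), h1]

end IsAxial

/-! ### Independence of the number of sources from the covector -/

/-- The contribution of an oriented edge, with values `x` and `y` of two covectors, to four times
the difference of the numbers of sources; the sign of `s` is the turning direction at its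
origin. -/
noncomputable def sourceFlow (s x y : ℝ) : ℤ :=
  if 0 < s then if 0 < x ∧ y < 0 then 4 else 0
  else if s < 0 then if x < 0 ∧ 0 < y then -4 else 0
  else (if 0 < x then 1 else -1) - (if 0 < y then 1 else -1)

/-- Reversing an edge negates both covector values and the turning direction, so the flow is
antisymmetric and cancels in the sum over all oriented edges. -/
theorem sourceFlow_neg {s s' x y : ℝ} (hs : ∃ l : ℝ, 0 < l ∧ s = -(l * s')) (hx : x ≠ 0)
    (hy : y ≠ 0) : sourceFlow s' (-x) (-y) = -sourceFlow s x y := by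
  obtain ⟨l, hl, rfl⟩ := hs
  have h1 : l * s' < 0 ↔ s' < 0 := ⟨fun h => not_le.1 fun h' => (mul_nonneg hl.le h').not_gt h,
    mul_neg_of_pos_of_neg hl⟩
  rcases hx.lt_or_gt with hx | hx <;> rcases hy.lt_or_gt with hy | hy <;>
    rcases lt_trichotomy s' 0 with h | h | h <;>
    simp [sourceFlow, hl, h, hx, hy, h.not_gt, hx.not_gt, hy.not_gt, h1]

/-- The two covectors map the two edges at a vertex to plane vectors `(x, y)` and `(x', y')`, whose
cross product gives the turning direction. The identity is checked quadrant by quadrant; for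
parallel vectors each edge carries half of the jump of 4. -/
theorem sourceFlow_add {x y x' y' : ℝ} (hx : x ≠ 0) (hy : y ≠ 0) (hx' : x' ≠ 0) (hy' : y' ≠ 0) :
    sourceFlow (x * y' - y * x') x y + sourceFlow (x' * y - y' * x) x' y' =
      4 * (if 0 < x ∧ 0 < x' then 1 else 0) - 4 * (if 0 < y ∧ 0 < y' then 1 else 0) := by
  have h : x' * y - y' * x = -(x * y' - y * x') := by ring
  rw [h]
  generalize hC : x * y' - y * x' = C
  clear h
  rcases hx.lt_or_gt with hx | hx <;> rcases hy.lt_or_gt with hy | hy <;>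
    rcases hx'.lt_or_gt with hx' | hx' <;> rcases hy'.lt_or_gt with hy' | hy' <;>
    rcases lt_trichotomy C 0 with h0 | h0 | h0 <;>
    first
    | (simp [sourceFlow, h0, hx, hy, hx', hy', hx.not_gt, hy.not_gt, hx'.not_gt, hy'.not_gt,
        h0.not_gt]; done)
    -- What remains are vectors in adjacent open quadrants, where the sign of the cross product is
    -- forced and contradicts `h0`.
    | (exfalso; clear * - hC h0 hx hy hx' hy'; nlinarith)

/-- On a finite graph all of whose non-isolated vertices are 2-valent, with two functions on the
oriented edges that satisfy a common three-term recurrence, the numbers of sources agree. -/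
theorem card_sources_eq [Fintype V] (H : V → V → Prop) (X Y : V → V → ℝ)
    (hsymm : ∀ {p q}, H p q → H q p)
    (hX : ∀ {p q}, H p q → X q p = -X p q) (hY : ∀ {p q}, H p q → Y q p = -Y p q)
    (hX0 : ∀ {p q}, H p q → X p q ≠ 0) (hY0 : ∀ {p q}, H p q → Y p q ≠ 0)
    (hcompat : ∀ {p q r}, H p q → H p r → ∃ r' l c, H q r' ∧ 0 < l ∧
      X p r = l * X q r' + c * X p q ∧ Y p r = l * Y q r' + c * Y p q ∧
        (r' = p → r = q))
    (hval : ∀ {p q}, H p q → ∃ a b, a ≠ b ∧ ∀ r, H p r ↔ r = a ∨ r = b) :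
    {p | (∃ q, H p q) ∧ ∀ q, H p q → 0 < X p q}.ncard =
      {p | (∃ q, H p q) ∧ ∀ q, H p q → 0 < Y p q}.ncard := by
  classical
  -- Summing over all neighbours avoids naming the second one: the term of `q` itself vanishes.
  let C : V → V → ℝ := fun p q => ∑ r, if H p r then X p q * Y p r - Y p q * X p r else 0
  have hC : ∀ {p a b : V}, a ≠ b → (∀ r, H p r ↔ r = a ∨ r = b) →
      C p a = X p a * Y p b - Y p a * X p b := by
    intro p a b hab h
    have h1 : ∀ r, (if H p r then X p a * Y p r - Y p a * X p r else 0) =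
        if r = b then X p a * Y p b - Y p a * X p b else 0 := by
      intro r
      by_cases hb : r = b
      · subst hb; simp [h]
      · by_cases ha : r = a
        · subst ha; simp [hb, mul_comm]
        · simp [h, ha, hb]
    simp only [C, h1, Finset.sum_ite_eq', Finset.mem_univ, if_true]
  have hval' : ∀ {p q : V}, H p q → ∃ r, q ≠ r ∧ ∀ s, H p s ↔ s = q ∨ s = r := by
    intro p q hpq
    obtain ⟨a, b, hab, h⟩ := hval hpq
    rcases (h q).1 hpq with rfl | rfl
    · exact ⟨b, hab, h⟩
    · exact ⟨a, hab.symm, fun s => by rw [h, or_comm]⟩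
  have hCsymm : ∀ {p q : V}, H p q → ∃ l : ℝ, 0 < l ∧ C p q = -(l * C q p) := by
    intro p q hpq
    obtain ⟨r, hqr, hr⟩ := hval' hpq
    obtain ⟨r', l, c, hqr', hl, h1, h2, h3⟩ := hcompat hpq ((hr r).2 (.inr rfl))
    obtain ⟨t, hpt, ht⟩ := hval' (hsymm hpq)
    -- The connection sends the other edge at `p` to the other edge at `q`. Thus both lie on the
    -- same side of the edge `pq`, and the turning sign flips under reversal.
    have htr : r' = t := ((ht r').1 hqr').resolve_left fun h => hqr (h3 h).symm
    refine ⟨l, hl, ?_⟩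
    rw [hC hqr hr, hC hpt ht, h1, h2, htr, hX hpq, hY hpq]
    ring
  let F : V → V → ℤ := fun p q => if H p q then sourceFlow (C p q) (X p q) (Y p q) else 0
  have hF : ∀ p q, F q p = -F p q := by
    intro p q
    by_cases h : H p q
    · simp only [F, h, hsymm h, if_true]
      rw [hX h, hY h, sourceFlow_neg (hCsymm h) (hX0 h) (hY0 h)]
    · have h' : ¬ H q p := fun h' => h (hsymm h')
      simp [F, h, h']
  have hsum : ∑ p, ∑ q, F p q = 0 := by
    have h1 : ∑ p, ∑ q, F p q = ∑ p, ∑ q, F q p := Finset.sum_comm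
    have h2 : ∑ p, ∑ q, F q p = -∑ p, ∑ q, F p q := by
      rw [← Finset.sum_neg_distrib]
      refine Finset.sum_congr rfl fun p _ => ?_
      rw [← Finset.sum_neg_distrib]
      exact Finset.sum_congr rfl fun q _ => hF p q
    omega
  have hvert : ∀ p, ∑ q, F p q =
      4 * (if (∃ q, H p q) ∧ ∀ q, H p q → 0 < X p q then 1 else 0) -
        4 * (if (∃ q, H p q) ∧ ∀ q, H p q → 0 < Y p q then 1 else 0) := by
    intro p
    by_cases hp : ∃ q, H p q
    · obtain ⟨q, hq⟩ := hp
      obtain ⟨a, b, hab, h⟩ := hval hq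
      have ha : H p a := (h a).2 (.inl rfl)
      have hb : H p b := (h b).2 (.inr rfl)
      have h1 : ∑ r, F p r = F p a + F p b := by
        refine Finset.sum_eq_add a b hab (fun r _ hr => ?_) (by simp) (by simp)
        have : ¬ H p r := by rw [h]; tauto
        simp [F, this]
      have h2 : ∀ Z : V → V → ℝ, ((∃ q, H p q) ∧ ∀ q, H p q → 0 < Z p q) ↔
          0 < Z p a ∧ 0 < Z p b := by
        intro Z
        refine ⟨fun hz => ⟨hz.2 a ha, hz.2 b hb⟩, fun hz => ⟨⟨a, ha⟩, fun r hr => ?_⟩⟩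
        rcases (h r).1 hr with rfl | rfl
        exacts [hz.1, hz.2]
      rw [h1, if_congr (h2 X) rfl rfl, if_congr (h2 Y) rfl rfl]
      simp only [F, ha, hb, if_true]
      rw [hC hab h, hC hab.symm fun r => by rw [h, or_comm]]
      exact sourceFlow_add (hX0 ha) (hY0 ha) (hX0 hb) (hY0 hb)
    · have : ∀ q, ¬ H p q := fun q hq => hp ⟨q, hq⟩
      simp [F, this]
  have hcard : ∀ Z : V → V → ℝ, ∑ p, (if (∃ q, H p q) ∧ ∀ q, H p q → 0 < Z p q then 1 else 0) =
      (({p | (∃ q, H p q) ∧ ∀ q, H p q → 0 < Z p q}.ncard : ℕ) : ℤ) := by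
    intro Z
    rw [Set.ncard_eq_toFinset_card', Finset.sum_boole, Set.toFinset_ofPred]
  simp only [hvert] at hsum
  rw [Finset.sum_sub_distrib, ← Finset.mul_sum, ← Finset.mul_sum, hcard X, hcard Y] at hsum
  omega

theorem connected_induction {H : P.G.Subgraph} (hH : H.Connected) {C : V → Prop} {p : V}
    (hp : p ∈ H.verts) (hC : C p) (hstep : ∀ {u v}, H.Adj u v → C u → C v) :
    ∀ v ∈ H.verts, C v := by
  intro v hv
  obtain ⟨γ⟩ := hH.preconnected.coe ⟨p, hp⟩ ⟨v, hv⟩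
  suffices ∀ {x y : H.verts}, H.coe.Walk x y → C x → C y from this γ hC
  intro x y γ
  induction γ with
  | nil => exact id
  | cons h _ ih => exact fun hx => ih (hstep h hx)

theorem index_eq_zero_iff [Finite V] {H : P.G.Subgraph} {ξ : Module.Dual ℝ (Fin n → ℝ)}
    (hξ : P.IsGenericOn α H ξ) (p : V) :
    P.index α H ξ p = 0 ↔ ∀ e : P.G.neighborSet p, H.Adj p e → 0 < ξ (α p e) := by
  rw [index, Set.ncard_eq_zero (Set.toFinite _), Set.eq_empty_iff_forall_notMem]
  refine forall_congr' fun e => ⟨fun h he => ?_, fun h he => (h he.1).not_gt he.2⟩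
  exact (hξ he).lt_or_gt.resolve_left fun h' => h ⟨he, h'⟩

/-- The number of sources of a 2-valent subskeleton does not depend on the generic covector. -/
theorem IsAxial.betti_zero_eq [Finite V] (hα : P.IsAxial α) {H : P.G.Subgraph}
    (hH : P.IsSubskeleton 2 H) {ξ η : Module.Dual ℝ (Fin n → ℝ)} (hξ : P.IsGenericOn α H ξ)
    (hη : P.IsGenericOn α H η) : P.betti α H ξ 0 = P.betti α H η 0 := by
  classical
  have := Fintype.ofFinite V
  let X : Module.Dual ℝ (Fin n → ℝ) → V → V → ℝ := fun ζ p q =>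
    if h : P.G.Adj p q then ζ (α p ⟨q, h⟩) else 0
  have hX : ∀ (ζ) {p q : V} (h : P.G.Adj p q), X ζ p q = ζ (α p ⟨q, h⟩) := fun ζ p q h => by
    simp only [X, dif_pos h]
  have hset : ∀ ζ, P.IsGenericOn α H ζ → {p : V | p ∈ H.verts ∧ P.index α H ζ p = 0} =
      {p | (∃ q, H.Adj p q) ∧ ∀ q, H.Adj p q → 0 < X ζ p q} := by
    intro ζ hζ
    ext p
    refine and_congr ⟨fun hp => ?_, fun ⟨q, hq⟩ => hq.fst_mem⟩ ?_
    · obtain ⟨a, _, -, hab⟩ := hH.exists_neighbors hp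
      exact ⟨a, (hab a).2 (.inl rfl)⟩
    · rw [index_eq_zero_iff hζ]
      refine ⟨fun h q hq => ?_, fun h e he => ?_⟩
      · rw [hX ζ hq.adj_sub]; exact h ⟨q, hq.adj_sub⟩ hq
      · rw [← hX ζ e.2]; exact h e he
  have hanti : ∀ (ζ) {p q}, H.Adj p q → X ζ q p = -X ζ p q := by
    intro ζ p q h
    rw [hX ζ h.adj_sub, hX ζ h.symm.adj_sub, hα.reverse h.symm.adj_sub, map_neg]
  rw [betti, betti, hset ξ hξ, hset η hη]
  refine card_sources_eq H.Adj (X ξ) (X η) (fun h => h.symm) (hanti ξ) (hanti η)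
    (fun h => by rw [hX ξ h.adj_sub]; exact hξ h) (fun h => by rw [hX η h.adj_sub]; exact hη h)
    (fun {p q r} hq hr => ?_) (fun {p q} h => ?_)
  -- The recurrence comes from a relation between vectors, so its constants are common to both
  -- covectors.
  · refine ⟨P.conn hq.adj_sub ⟨r, hr.adj_sub⟩, P.lam hq.adj_sub ⟨r, hr.adj_sub⟩,
      hα.coeff hq.adj_sub ⟨r, hr.adj_sub⟩, hH.totally_geodesic hq _ hr, P.lam_pos _ _,
      ?_, ?_, ?_⟩
    · rw [hX ξ hr.adj_sub, hX ξ hq.adj_sub, hX ξ (P.conn hq.adj_sub ⟨r, hr.adj_sub⟩).2,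
        hα.coeff_spec hq.adj_sub ⟨r, hr.adj_sub⟩, hα.reverse hq.adj_sub]
      simp [sub_eq_add_neg]
    · rw [hX η hr.adj_sub, hX η hq.adj_sub, hX η (P.conn hq.adj_sub ⟨r, hr.adj_sub⟩).2,
        hα.coeff_spec hq.adj_sub ⟨r, hr.adj_sub⟩, hα.reverse hq.adj_sub]
      simp [sub_eq_add_neg]
    · have h1 := P.conn_self hq.adj_sub
      intro h
      have h2 : P.conn hq.adj_sub ⟨r, hr.adj_sub⟩ = P.conn hq.adj_sub ⟨q, hq.adj_sub⟩ := by
        rw [h1]; exact Subtype.ext h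
      exact congrArg Subtype.val ((P.conn hq.adj_sub).injective h2)
  · exact Set.ncard_eq_two.mp (hH.valency p h.fst_mem) |>.imp fun a => Exists.imp fun b hab =>
      ⟨hab.1, fun r => by rw [← SimpleGraph.Subgraph.mem_neighborSet, hab.2]; simp⟩

/-! ### 2-slices as 2-valent subskeletons -/

theorem IsIndependent.card_le_finrank {k : ℕ} (hk : P.IsIndependent k α)
    {W : Submodule ℝ (Fin n → ℝ)} {p : V} (s : Finset (P.G.neighborSet p)) (hs : s.card ≤ k)
    (hW : ∀ e ∈ s, α p e ∈ W) : s.card ≤ Module.finrank ℝ W := by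
  have h1 := finrank_span_eq_card (hk p s hs)
  rw [Fintype.card_coe] at h1
  rw [← h1]
  refine Submodule.finrank_mono (Submodule.span_le.2 ?_)
  rintro _ ⟨e, rfl⟩
  exact hW e e.2

theorem IsIndependent.eq_or_eq_of_mem_plane (h3 : P.IsIndependent 3 α)
    {W : Submodule ℝ (Fin n → ℝ)} (hW : Module.finrank ℝ W = 2) {p : V}
    {a b c : P.G.neighborSet p} (hab : a ≠ b) (ha : α p a ∈ W) (hb : α p b ∈ W)
    (hc : α p c ∈ W) : c = a ∨ c = b := by
  classical
  by_contra! h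
  have h1 : ({a, b, c} : Finset (P.G.neighborSet p)).card = 3 :=
    Finset.card_eq_three.2 ⟨a, b, c, hab, h.1.symm, h.2.symm, rfl⟩
  have h2 := h3.card_le_finrank {a, b, c} h1.le (W := W) (by simp [ha, hb, hc])
  omega

/-- The third condition in the definition of a slice. -/
def IsCutBy (P : PreOneSkeleton V d) (α : P.EdgeFun n) (W : Submodule ℝ (Fin n → ℝ))
    (H : P.G.Subgraph) : Prop :=
  ∀ p q : V, H.Adj p q ↔ p ∈ H.verts ∧ ∃ h : P.G.Adj p q, α p ⟨q, h⟩ ∈ W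

namespace IsAxial

/-- Compatibility puts the transported edge vector in the span of two vectors that lie in `W`. -/
theorem isGeodesic_of_isCutBy (hα : P.IsAxial α) {W : Submodule ℝ (Fin n → ℝ)}
    {H : P.G.Subgraph} (hH : P.IsCutBy α W H) : P.IsGeodesic H := by
  intro p q h e he
  refine (hH _ _).2 ⟨h.snd_mem, (P.conn h.adj_sub e).2, ?_⟩
  obtain ⟨-, _, h1⟩ := (hH _ _).1 he
  obtain ⟨-, _, h2⟩ := (hH _ _).1 h.symm
  have h3 := W.smul_mem (P.lam h.adj_sub e)⁻¹
    (W.add_mem h1 (W.smul_mem (hα.coeff h.adj_sub e) h2))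
  have h4 := hα.coeff_spec h.adj_sub e
  have hl := (P.lam_pos h.adj_sub e).ne'
  have h5 : α q (P.conn h.adj_sub e) = (P.lam h.adj_sub e)⁻¹ •
      (α p e + hα.coeff h.adj_sub e • α q ⟨p, h.symm.adj_sub⟩) := by
    rw [h4, sub_add_cancel, inv_smul_smul₀ hl]
  exact h5 ▸ h3

end IsAxial

/-- In a connected totally geodesic subgraph, if one vertex has two neighbours then all do. -/
theorem IsGeodesic.exists_two_neighbors {H : P.G.Subgraph} (hH : P.IsGeodesic H)
    (hconn : H.Connected) {p : V} {a b : P.G.neighborSet p} (hab : a ≠ b) (ha : H.Adj p a)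
    (hb : H.Adj p b) : ∀ v ∈ H.verts, ∃ a b : P.G.neighborSet v, a ≠ b ∧ H.Adj v a ∧
      H.Adj v b := by
  refine connected_induction hconn ha.fst_mem ⟨a, b, hab, ha, hb⟩ ?_
  rintro u v huv ⟨a, b, hab, ha, hb⟩
  exact ⟨P.conn huv.adj_sub a, P.conn huv.adj_sub b, fun h => hab ((P.conn _).injective h),
    hH huv a ha, hH huv b hb⟩

/-- Injectivity of the connection spreads two edges from one vertex to all of `H`; 3-independence
excludes a third edge vector in a plane. -/
theorem IsAxial.isSubskeleton_of_isCutBy (hα : P.IsAxial α) (h3 : P.IsIndependent 3 α)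
    {W : Submodule ℝ (Fin n → ℝ)} (hW : Module.finrank ℝ W = 2) {H : P.G.Subgraph}
    (hH : P.IsCutBy α W H) (hconn : H.Connected) {p : V} {a b : P.G.neighborSet p}
    (hab : a ≠ b) (ha : H.Adj p a) (hb : H.Adj p b) : P.IsSubskeleton 2 H where
  connected := hconn
  totally_geodesic := hα.isGeodesic_of_isCutBy hH
  valency v hv := by
    obtain ⟨a, b, hab, ha, hb⟩ :=
      IsGeodesic.exists_two_neighbors (hα.isGeodesic_of_isCutBy hH) hconn hab ha hb v hv
    refine Set.ncard_eq_two.2 ⟨a, b, fun h => hab (Subtype.ext h), ?_⟩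
    ext c
    simp only [SimpleGraph.Subgraph.mem_neighborSet, Set.mem_insert_iff, Set.mem_singleton_iff]
    refine ⟨fun hc => ?_, fun hc => by rcases hc with rfl | rfl <;> assumption⟩
    obtain ⟨-, h1, hcW⟩ := (hH _ _).1 hc
    obtain ⟨-, _, haW⟩ := (hH _ _).1 ha
    obtain ⟨-, _, hbW⟩ := (hH _ _).1 hb
    exact (h3.eq_or_eq_of_mem_plane hW hab haW hbW hcW).imp (congrArg Subtype.val)
      (congrArg Subtype.val)

/-- Any subspace and any vertex determine a connected component of the graph of the edges with
direction in that subspace. -/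
theorem IsAxial.exists_isCutBy (hα : P.IsAxial α) (W : Submodule ℝ (Fin n → ℝ)) (p : V) :
    ∃ H : P.G.Subgraph, H.Connected ∧ p ∈ H.verts ∧ P.IsCutBy α W H := by
  let R : V → V → Prop := fun u v => ∃ h : P.G.Adj u v, α u ⟨v, h⟩ ∈ W
  have hR : ∀ {u v}, R u v → R v u := fun {u v} ⟨h, hW⟩ =>
    ⟨h.symm, by rw [hα.reverse h.symm]; exact W.neg_mem hW⟩
  let H : P.G.Subgraph :=
    { verts := {v | Relation.ReflTransGen R p v}
      Adj := fun u v => Relation.ReflTransGen R p u ∧ R u v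
      adj_sub := fun h => h.2.1
      edge_vert := fun h => h.1
      symm := ⟨fun u v h => ⟨h.1.tail h.2, hR h.2⟩⟩ }
  refine ⟨H, ?_, Relation.ReflTransGen.refl, fun u v => Iff.rfl⟩
  have hp : p ∈ H.verts := Relation.ReflTransGen.refl
  have key : ∀ v (hv : Relation.ReflTransGen R p v), H.coe.Reachable ⟨p, hp⟩ ⟨v, hv⟩ := by
    intro v hv
    induction hv with
    | refl => rfl
    | tail hu huv ih => exact ih.trans (SimpleGraph.Adj.reachable (G := H.coe) ⟨hu, huv⟩)
  rw [SimpleGraph.Subgraph.connected_iff, SimpleGraph.Subgraph.preconnected_iff]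
  exact ⟨fun x y => (key x x.2).symm.trans (key y y.2), ⟨p, hp⟩⟩

theorem IsAxial.exists_slice (hα : P.IsAxial α) (h3 : P.IsIndependent 3 α) {p : V}
    {a b : P.G.neighborSet p} (hab : a ≠ b) :
    ∃ H : P.G.Subgraph, P.IsSlice α 2 H ∧ P.IsSubskeleton 2 H ∧ H.Adj p a ∧ H.Adj p b := by
  classical
  have hcard : ({a, b} : Finset (P.G.neighborSet p)).card = 2 := Finset.card_pair hab
  let W := Submodule.span ℝ (Set.range fun e : ({a, b} : Finset (P.G.neighborSet p)) => α p e)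
  have hW : Module.finrank ℝ W = 2 := by
    rw [finrank_span_eq_card (hα.pairwise_indep p {a, b} hcard.le), Fintype.card_coe, hcard]
  obtain ⟨H, hconn, hp, hH⟩ := hα.exists_isCutBy W p
  have ha : H.Adj p a := (hH _ _).2 ⟨hp, a.2, Submodule.subset_span ⟨⟨a, by simp⟩, rfl⟩⟩
  have hb : H.Adj p b := (hH _ _).2 ⟨hp, b.2, Submodule.subset_span ⟨⟨b, by simp⟩, rfl⟩⟩
  exact ⟨H, ⟨W, hW, hconn, ⟨p, a, ha⟩, hH⟩,
    hα.isSubskeleton_of_isCutBy h3 hW hH hconn hab ha hb, ha, hb⟩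

/-! ### Flat coordinates by induction along a polarization -/

theorem IsPolarizing.wellFounded [Finite V] {ξ : Module.Dual ℝ (Fin n → ℝ)}
    (hξ : P.IsPolarizing α ξ) : WellFounded (Relation.TransGen (P.IsDirected α ξ)) := by
  have : Std.Irrefl (Relation.TransGen (P.IsDirected α ξ)) := ⟨hξ.2⟩
  exact Finite.wellFounded_of_trans_of_irrefl _

theorem IsGenericOn.mono {H K : P.G.Subgraph} {ξ : Module.Dual ℝ (Fin n → ℝ)}
    (hξ : P.IsGenericOn α K ξ) (hHK : H ≤ K) : P.IsGenericOn α H ξ :=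
  fun h => hξ (hHK.2 h)

theorem IsAxial.isDirected_of_neg (hα : P.IsAxial α) {ξ : Module.Dual ℝ (Fin n → ℝ)} {p : V}
    {e : P.G.neighborSet p} (he : ξ (α p e) < 0) : P.IsDirected α ξ e p := by
  refine ⟨e.2.symm, ?_⟩
  rw [hα.reverse e.2.symm, map_neg]
  exact neg_pos.2 he

/-- From any vertex of `H` a source of `H` is reached by descending along edges of `H`. -/
theorem IsAxial.exists_walk_source [Finite V] (hα : P.IsAxial α)
    {ξ : Module.Dual ℝ (Fin n → ℝ)} (hξ : P.IsPolarizing α ξ) (H : P.G.Subgraph) (v : V)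
    (hv : v ∈ H.verts) : ∃ s, s ∈ H.verts ∧ P.index α H ξ s = 0 ∧ ∃ γ : P.G.Walk v s,
      γ.toSubgraph ≤ H ∧ ∀ u ∈ γ.support, Relation.ReflTransGen (P.IsDirected α ξ) u v := by
  induction v using hξ.wellFounded.induction with
  | _ v ih =>
    by_cases h0 : P.index α H ξ v = 0
    · refine ⟨v, hv, h0, .nil, ?_, ?_⟩
      · simpa [SimpleGraph.singletonSubgraph_le_iff] using hv
      · intro u hu
        rw [SimpleGraph.Walk.support_nil, List.mem_singleton] at hu
        exact hu ▸ .refl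
    · obtain ⟨e, he, hneg⟩ := Set.nonempty_of_ncard_ne_zero h0
      have hdir := hα.isDirected_of_neg hneg
      have hadj : P.G.Adj v e := e.2
      obtain ⟨s, hs, hs0, γ, hγ, hsupp⟩ := ih e (.single hdir) he.snd_mem
      refine ⟨s, hs, hs0, .cons hadj γ, toSubgraph_cons_le.2 ⟨he, hγ⟩, fun u hu => ?_⟩
      rw [SimpleGraph.Walk.support_cons, List.mem_cons] at hu
      rcases hu with rfl | hu
      · exact .refl
      · exact (hsupp u hu).tail hdir

/-- A family of coordinates on the edges at each vertex that is compatible with transport along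
the edges inside `S`. -/
def IsAxial.IsFlatOn (hα : P.IsAxial α) (S : Set V)
    (τ : ∀ v, (P.G.neighborSet v →₀ ℝ) ≃ₗ[ℝ] (Fin d → ℝ)) : Prop :=
  ∀ {p q : V} (h : P.G.Adj p q), p ∈ S → q ∈ S → ∀ x, τ q (hα.step h x) = τ p x

theorem IsAxial.IsFlatOn.transport {hα : P.IsAxial α} {S : Set V}
    {τ : ∀ v, (P.G.neighborSet v →₀ ℝ) ≃ₗ[ℝ] (Fin d → ℝ)} (hτ : hα.IsFlatOn S τ) {p q : V}
    (γ : P.G.Walk p q) (hγ : ∀ u ∈ γ.support, u ∈ S) (x : P.G.neighborSet p →₀ ℝ) :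
    τ q (hα.transport γ x) = τ p x := by
  induction γ with
  | nil => rfl
  | cons h γ ih =>
    simp only [SimpleGraph.Walk.support_cons, List.mem_cons, forall_eq_or_imp] at hγ
    rw [transport_cons, ih hγ.2, hτ h hγ.1 (hγ.2 _ γ.start_mem_support)]

/-- The coordinates at two neighbours of `p` below `p` agree at `p`. -/
theorem IsAxial.IsFlatOn.step_eq_step [Finite V] {hα : P.IsAxial α} (h4 : P.IsIndependent 4 α)
    (hnc : P.IsNoncyclic α) {ξ : Module.Dual ℝ (Fin n → ℝ)} (hξ : P.IsPolarizing α ξ)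
    {S : Set V} (hS : ∀ {u v}, P.IsDirected α ξ u v → v ∈ S → u ∈ S)
    {τ : ∀ v, (P.G.neighborSet v →₀ ℝ) ≃ₗ[ℝ] (Fin d → ℝ)} (hτ : hα.IsFlatOn S τ) {p : V}
    {a b : V} (hpa : P.G.Adj p a) (hpb : P.G.Adj p b) (ha : a ∈ S) (hb : b ∈ S)
    (x : P.G.neighborSet p →₀ ℝ) : τ a (hα.step hpa x) = τ b (hα.step hpb x) := by
  by_cases hab : a = b
  · subst hab; rfl
  obtain ⟨H, hslice, hH, hHa, hHb⟩ := hα.exists_slice hnc.three_indep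
    (a := ⟨a, hpa⟩) (b := ⟨b, hpb⟩) fun h => hab (congrArg Subtype.val h)
  obtain ⟨η, hη, h1⟩ := hnc.slices_pointed H hslice
  -- The slice is pointed for `η`, but the descent follows `ξ`; the source count is the same, so
  -- both descents end at the same vertex.
  rw [hα.betti_zero_eq hH hη (IsGenericOn.mono hξ.1 le_top), betti, Set.ncard_eq_one] at h1
  obtain ⟨t, ht⟩ := h1
  have hS' : ∀ {u v}, Relation.ReflTransGen (P.IsDirected α ξ) u v → v ∈ S → u ∈ S := by
    intro u v huv hv
    induction huv using Relation.ReflTransGen.head_induction_on with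
    | refl => exact hv
    | head h _ ih => exact hS h ih
  obtain ⟨s, hs, hs0, γ, hγ, hγS⟩ := hα.exists_walk_source hξ H a hHa.snd_mem
  obtain ⟨s', hs', hs0', δ, hδ, hδS⟩ := hα.exists_walk_source hξ H b hHb.snd_mem
  have e1 : s = t := by
    have : s ∈ ({t} : Set V) := ht ▸ ⟨hs, hs0⟩
    exact this
  have e2 : s' = t := by
    have : s' ∈ ({t} : Set V) := ht ▸ ⟨hs', hs0'⟩
    exact this
  subst e1
  subst e2
  -- The descending walks stay in the down-set, so flatness moves both sides to the source. There
  -- they are transports from `p` along two walks in the slice.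
  rw [← hτ.transport γ (fun u hu => hS' (hγS u hu) ha),
    ← hτ.transport δ (fun u hu => hS' (hδS u hu) hb), ← transport_cons, ← transport_cons,
    hα.transport_eq_transport h4 hH (.cons hpa γ) (.cons hpb δ)
      (toSubgraph_cons_le.2 ⟨hHa, hγ⟩) (toSubgraph_cons_le.2 ⟨hHb, hδ⟩)]

/-- Flat coordinates on the down-set `S` extend to one more vertex. -/
theorem IsAxial.IsFlatOn.exists_insert [Finite V] {hα : P.IsAxial α} (h4 : P.IsIndependent 4 α)
    (hnc : P.IsNoncyclic α) {ξ : Module.Dual ℝ (Fin n → ℝ)} (hξ : P.IsPolarizing α ξ)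
    {S : Set V} (hS : ∀ {u v}, P.IsDirected α ξ u v → v ∈ S → u ∈ S)
    {τ : ∀ v, (P.G.neighborSet v →₀ ℝ) ≃ₗ[ℝ] (Fin d → ℝ)} (hτ : hα.IsFlatOn S τ) {p : V}
    (hp : p ∉ S) : ∃ τ', hα.IsFlatOn (insert p S) τ' := by
  classical
  by_cases hdown : ∃ a, P.G.Adj p a ∧ a ∈ S
  · obtain ⟨a, hpa, ha⟩ := hdown
    -- The coordinates at `p` are pulled back from one neighbour in `S`; `key` makes the choice
    -- immaterial.
    refine ⟨Function.update τ p ((hα.stepEquiv hpa).trans (τ a)), ?_⟩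
    have key : ∀ {q : V} (h : P.G.Adj p q), q ∈ S → ∀ x,
        τ q (hα.step h x) = τ a (hα.step hpa x) := fun {q} h hq x =>
      hτ.step_eq_step h4 hnc hξ hS h hpa hq ha x
    intro u v h hu hv x
    rcases hu with rfl | hu <;> rcases hv with rfl | hv
    · exact absurd h (P.G.irrefl)
    · have hne : v ≠ u := fun h' => hp (h' ▸ hv)
      rw [Function.update_of_ne hne, Function.update_self, key h hv]
      rfl
    · have hne : u ≠ v := fun h' => hp (h' ▸ hu)
      rw [Function.update_of_ne hne, Function.update_self, LinearEquiv.trans_apply,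
        stepEquiv_apply, ← key h.symm hu, hα.step_symm_step]
    · have hne : u ≠ p := fun h' => hp (h' ▸ hu)
      have hne' : v ≠ p := fun h' => hp (h' ▸ hv)
      rw [Function.update_of_ne hne, Function.update_of_ne hne', hτ h hu hv]
  · refine ⟨τ, ?_⟩
    intro u v h hu hv x
    rcases hu with rfl | hu <;> rcases hv with rfl | hv
    · exact absurd h (P.G.irrefl)
    · exact absurd ⟨v, h, hv⟩ hdown
    · exact absurd ⟨u, h.symm, hu⟩ hdown
    · exact hτ h hu hv x

theorem exists_linearEquiv [Finite V] (P : PreOneSkeleton V d) (v : V) :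
    Nonempty ((P.G.neighborSet v →₀ ℝ) ≃ₗ[ℝ] (Fin d → ℝ)) := by
  have e : P.G.neighborSet v ≃ Fin d := Finite.equivFinOfCardEq (P.valency v)
  exact ⟨(Finsupp.domLCongr e).trans (Finsupp.linearEquivFunOnFinite ℝ ℝ (Fin d))⟩

/-- A maximal down-closed set with flat coordinates must be everything: a minimal vertex of its
complement could be added, keeping the set down-closed. -/
theorem IsAxial.exists_isFlatOn_univ [Finite V] (hα : P.IsAxial α) (h4 : P.IsIndependent 4 α)
    (hnc : P.IsNoncyclic α) :
    ∃ τ : ∀ v, (P.G.neighborSet v →₀ ℝ) ≃ₗ[ℝ] (Fin d → ℝ), hα.IsFlatOn Set.univ τ := by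
  obtain ⟨ξ, hξ⟩ := hnc.polarization
  let Good : Set V → Prop := fun S =>
    (∀ {u v}, P.IsDirected α ξ u v → v ∈ S → u ∈ S) ∧ ∃ τ, hα.IsFlatOn S τ
  have hne : {S | Good S}.Nonempty := by
    exact ⟨∅, fun _ h => h, fun v => (P.exists_linearEquiv v).some,
      fun _ h => absurd h (Set.notMem_empty _)⟩
  obtain ⟨S, hS⟩ := (Set.toFinite {S | Good S}).exists_maximal hne
  obtain ⟨⟨hlow, τ, hτ⟩, hmax⟩ := hS
  suffices S = Set.univ from ⟨τ, this ▸ hτ⟩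
  by_contra hSu
  obtain ⟨p, hp, hmin⟩ := hξ.wellFounded.has_min Sᶜ (Set.nonempty_compl.2 hSu)
  have hgood : Good (insert p S) := by
    refine ⟨fun {u v} huv hv => ?_, hτ.exists_insert h4 hnc hξ hlow hp⟩
    rcases hv with rfl | hv
    · exact .inr (by_contra fun hu => hmin u hu (.single huv))
    · exact .inr (hlow huv hv)
  exact hp (hmax hgood (Set.subset_insert p S) (Set.mem_insert p S))

/-! ### Noncyclicity of lifts -/

/-- A slice without a vertex with two neighbours is a single edge, hence pointed. -/
theorem IsAxial.isPointed_of_subsingleton [Finite V] (hα : P.IsAxial α)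
    {ξ : Module.Dual ℝ (Fin n → ℝ)} (hξ : P.IsGenericOn α ⊤ ξ) {H : P.G.Subgraph}
    (hconn : H.Connected) (hne : ∃ p q : V, H.Adj p q)
    (hsub : ∀ {v a b : V}, H.Adj v a → H.Adj v b → a = b) : P.IsPointed α H := by
  have hgen : P.IsGenericOn α H ξ := IsGenericOn.mono hξ le_top
  obtain ⟨p, q, hpq, hpos⟩ : ∃ p q, ∃ h : H.Adj p q, 0 < ξ (α p ⟨q, h.adj_sub⟩) := by
    obtain ⟨p, q, h⟩ := hne
    rcases (hgen h).lt_or_gt with h' | h'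
    · refine ⟨q, p, h.symm, ?_⟩
      rw [hα.reverse h.symm.adj_sub, map_neg]
      exact neg_pos.2 h'
    · exact ⟨p, q, h, h'⟩
  have hverts : ∀ v ∈ H.verts, v = p ∨ v = q := by
    refine connected_induction hconn hpq.fst_mem (.inl rfl) ?_
    rintro u v huv (rfl | rfl)
    · exact .inr (hsub huv hpq)
    · exact .inl (hsub huv hpq.symm)
  refine ⟨ξ, hgen, Set.ncard_eq_one.2 ⟨p, ?_⟩⟩
  ext v
  rw [Set.mem_singleton_iff, Set.mem_ofPred_eq, index_eq_zero_iff hgen]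
  refine ⟨fun ⟨hv, h0⟩ => (hverts v hv).resolve_right ?_, ?_⟩
  · rintro rfl
    have h1 := h0 ⟨p, hpq.symm.adj_sub⟩ hpq.symm
    rw [hα.reverse hpq.symm.adj_sub, map_neg] at h1
    exact (neg_pos.1 h1).not_gt hpos
  · rintro rfl
    refine ⟨hpq.fst_mem, fun e he => ?_⟩
    have h1 : e = ⟨q, hpq.adj_sub⟩ := Subtype.ext (hsub he hpq)
    exact h1 ▸ hpos

/-- A lift of a noncyclic 1-skeleton is noncyclic. -/
theorem IsNoncyclic.lift [Finite V] (hnc : P.IsNoncyclic α) (hα : P.IsAxial α)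
    {m : ℕ} {A : P.EdgeFun m} (hA : P.IsAxial A) (h3 : P.IsIndependent 3 A)
    (π : (Fin m → ℝ) →ₗ[ℝ] (Fin n → ℝ)) (hπ : ∀ p e, π (A p e) = α p e) :
    P.IsNoncyclic A := by
  classical
  obtain ⟨ξ, hξ⟩ := hnc.polarization
  have hval : ∀ (ζ : Module.Dual ℝ (Fin n → ℝ)) (p) (e : P.G.neighborSet p),
      (ζ ∘ₗ π) (A p e) = ζ (α p e) := fun ζ p e => by rw [LinearMap.comp_apply, hπ]
  have hgen : ∀ {H : P.G.Subgraph} {ζ : Module.Dual ℝ (Fin n → ℝ)}, P.IsGenericOn α H ζ →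
      P.IsGenericOn A H (ζ ∘ₗ π) := fun h _ _ hpq => by rw [hval]; exact h hpq
  have hdir : P.IsDirected A (ξ ∘ₗ π) = P.IsDirected α ξ := by
    ext p q
    simp only [IsDirected, hval]
  have hpol : P.IsPolarizing A (ξ ∘ₗ π) := ⟨hgen hξ.1, by rw [hdir]; exact hξ.2⟩
  refine ⟨h3, ⟨_, hpol⟩, ?_⟩
  rintro H ⟨W, hW, hconn, hne, hcut⟩
  -- A single-edge slice is treated apart: the image of its plane under `π` may degenerate or
  -- contain further edge directions of `α`.
  by_cases hsub : ∀ {v a b : V}, H.Adj v a → H.Adj v b → a = b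
  · exact hA.isPointed_of_subsingleton hpol.1 hconn hne hsub
  push Not at hsub
  obtain ⟨v, a, b, ha, hb, hab⟩ := hsub
  have htwo := IsGeodesic.exists_two_neighbors (hA.isGeodesic_of_isCutBy hcut) hconn
    (a := ⟨a, ha.adj_sub⟩) (b := ⟨b, hb.adj_sub⟩) (fun h => hab (congrArg Subtype.val h)) ha hb
  have hmem : ∀ {p} {e : P.G.neighborSet p}, H.Adj p e → α p e ∈ W.map π := by
    intro p e he
    obtain ⟨-, _, h⟩ := (hcut _ _).1 he
    exact ⟨_, h, hπ p e⟩
  have hW' : Module.finrank ℝ (W.map π) = 2 := by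
    -- The plane does not collapse, since its image contains two independent edge vectors of `α`.
    refine le_antisymm (hW ▸ Submodule.finrank_map_le π W) ?_
    have hne' : (⟨a, ha.adj_sub⟩ : P.G.neighborSet v) ≠ ⟨b, hb.adj_sub⟩ :=
      fun h => hab (congrArg Subtype.val h)
    have hcard := Finset.card_pair hne'
    rw [← hcard]
    refine hα.pairwise_indep.card_le_finrank _ hcard.le fun e he => hmem ?_
    rw [Finset.mem_insert, Finset.mem_singleton] at he
    rcases he with rfl | rfl <;> assumption
  have hslice : P.IsSlice α 2 H := by
    refine ⟨W.map π, hW', hconn, hne, fun p q => ⟨fun h => ?_, ?_⟩⟩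
    · exact ⟨h.fst_mem, h.adj_sub, hmem h⟩
    -- No new edges enter the slice downstairs: two edges of `H` at `p` already lie in the image
    -- plane, and 3-independence of `α` leaves no room for a third.
    · rintro ⟨hp, h, hq⟩
      obtain ⟨a, b, hab, ha, hb⟩ := htwo p hp
      rcases hnc.three_indep.eq_or_eq_of_mem_plane hW' hab (hmem ha) (hmem hb) hq with e | e
      · rw [← e] at ha; exact ha
      · rw [← e] at hb; exact hb
  obtain ⟨η, hη, h1⟩ := hnc.slices_pointed H hslice
  refine ⟨η ∘ₗ π, hgen hη, ?_⟩
  rw [← h1]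
  simp only [betti, index, hval]

/-! ### The total lift -/

/-- A 4-independent noncyclic 1-skeleton has a total lift, which is again noncyclic. -/
theorem IsAxial.exists_isTotalLift [Finite V] (hα : P.IsAxial α) (h4 : P.IsIndependent 4 α)
    (hnc : P.IsNoncyclic α) :
    ∃ (A : P.EdgeFun d) (π : (Fin d → ℝ) →ₗ[ℝ] (Fin n → ℝ)),
      P.IsTotalLift α A π ∧ P.IsIndependent d A ∧ P.IsNoncyclic A := by
  obtain ⟨τ, hτ⟩ := hα.exists_isFlatOn_univ h4 hnc
  let A : P.EdgeFun d := fun p e => τ p (Finsupp.single e 1)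
  have hbasis : ∀ p, ⇑(Finsupp.basisSingleOne.map (τ p)) = A p := fun p => by
    ext1 e
    simp [A]
  have hlin : ∀ p, LinearIndependent ℝ (A p) := fun p => by
    rw [← hbasis]; exact Module.Basis.linearIndependent _
  have hspan : ∀ p, Submodule.span ℝ (Set.range (A p)) = ⊤ := fun p => by
    rw [← hbasis]; exact Module.Basis.span_eq _
  have hind : ∀ k, P.IsIndependent k A := fun k p s _ =>
    (hlin p).comp _ Subtype.val_injective
  have hA : P.IsAxial A := by
    refine ⟨hind 2, fun {p q} h => ?_, fun {p q} h e _ => ⟨hα.coeff h e, ?_⟩⟩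
    · have h1 := hτ h trivial trivial (Finsupp.single ⟨q, h⟩ 1)
      rw [hα.step_self, map_neg] at h1
      exact h1.symm
    · have h1 := hτ h trivial trivial (Finsupp.single e 1)
      have h2 := hτ h trivial trivial (Finsupp.single ⟨q, h⟩ 1)
      rw [hα.step_self, map_neg] at h2
      rw [hα.step_single, map_sub, map_smul, map_smul] at h1
      simp only [A]
      rw [← h1, ← h2]
      module
  obtain ⟨p₀⟩ := P.connected.nonempty
  -- Any base vertex serves: walks from other vertices to `p₀` preserve both the coordinates and
  -- evaluation by `α`.
  let π : (Fin d → ℝ) →ₗ[ℝ] (Fin n → ℝ) :=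
    (Finsupp.linearCombination ℝ (α p₀)).comp (τ p₀).symm.toLinearMap
  have hπ : ∀ p e, π (A p e) = α p e := by
    intro p e
    obtain ⟨γ⟩ := P.connected.preconnected p p₀
    have h1 := hτ.transport γ (fun _ _ => trivial) (Finsupp.single e 1)
    simp only [π, A, LinearMap.comp_apply, LinearEquiv.coe_coe]
    rw [← h1, LinearEquiv.symm_apply_apply, hα.linearCombination_transport,
      Finsupp.linearCombination_single, one_smul]
  refine ⟨A, π, ⟨hA, hspan, hπ, le_antisymm ?_ (Submodule.span_le.2 ?_)⟩, hind d,
    hnc.lift hα hA (hind 3) π hπ⟩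
  · rw [LinearMap.range_eq_map, ← hspan p₀, Submodule.map_span, Submodule.span_le]
    rintro _ ⟨_, ⟨e, rfl⟩, rfl⟩
    exact Submodule.subset_span ⟨p₀, e, (hπ p₀ e).symm⟩
  · rintro _ ⟨p, e, rfl⟩
    exact ⟨_, hπ p e⟩

/-- The linear map of a total lift of an effective axial function is surjective. -/
theorem IsTotalLift.surjective {A : P.EdgeFun d} {π : (Fin d → ℝ) →ₗ[ℝ] (Fin n → ℝ)}
    (h : P.IsTotalLift α A π) (hα : P.IsEffective α) : Function.Surjective π := by
  obtain ⟨p⟩ := P.connected.nonempty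
  rw [← LinearMap.range_eq_top, h.range_eq, eq_top_iff, ← hα p]
  refine Submodule.span_mono ?_
  rintro _ ⟨e, rfl⟩
  exact ⟨p, e, rfl⟩

end PreOneSkeleton

theorem mainTheorem3 {V : Type*} [Finite V] {d n : ℕ} (P : PreOneSkeleton V d)
    (α : P.EdgeFun n) (hα : P.IsAxial α) :
    (∀ k : ℕ, 3 ≤ k → P.IsIndependent k α →
      ∀ ξ : Module.Dual ℝ (Fin n → ℝ), P.IsGenericOn α ⊤ ξ →
        ∀ Q : P.G.Subgraph, P.IsFace α ξ 2 Q → P.IsLevel Q) ∧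
    (∀ k : ℕ, 4 ≤ k → P.IsIndependent k α →
      ∀ ξ : Module.Dual ℝ (Fin n → ℝ), P.IsGenericOn α ⊤ ξ →
        ∀ Q : P.G.Subgraph, P.IsFace α ξ 2 Q →
          P.IsLevel Q ∧ P.HasTrivialNormalHolonomy Q) ∧
    (P.IsIndependent 4 α → P.IsNoncyclic α →
      ∃ (A : P.EdgeFun d) (π : (Fin d → ℝ) →ₗ[ℝ] (Fin n → ℝ)),
        P.IsTotalLift α A π ∧ P.IsIndependent d A ∧ P.IsNoncyclic A ∧
        (P.IsEffective α → Function.Surjective π)) := by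
  refine ⟨fun k hk hind ξ _ Q hQ => hα.isLevel (hind.mono hk) hQ.1,
    fun k hk hind ξ _ Q hQ => ⟨hα.isLevel (hind.mono (by omega)) hQ.1,
      hα.hasTrivialNormalHolonomy (hind.mono hk) hQ.1⟩, fun h4 hnc => ?_⟩
  obtain ⟨A, π, hlift, hind, hA⟩ := hα.exists_isTotalLift h4 hnc
  exact ⟨A, π, hlift, hind, hA, hlift.surjective⟩
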